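/- Let $G=(V,E)$ be a finite connected graph without self-loops and double edges, and let $d_v\in\mathbb{N}$ for $v\in V$. A PEPS $A$ on $G$ with physical spaces $\mathbb{C}^{d_v}$ consists of bond dimensions $D_e\ge 1$ ($e\in E$) and of a tensor $A_v=(A_v)^{i}_{\alpha}$ at each vertex $v$, with one physical index $i\in\{1,\dots,d_v\}$ and one virtual index $\alpha_e\in\{1,\dots,D_e\}$ for each edge $e$ incident to $v$, where $\alpha=(\alpha_e)_{e\ni v}$. The PEPS generates the state in $\bigotimes_{v\in V}\mathbb{C}^{d_v}$ obtained by contracting all edges, $$|\Psi_A\rangle=\sum_{(i_v)_{v\in V}}\Big(\sum_{(\sigma_e)_{e\in E}}\prod_{v\in V}(A_v)^{i_v}_{(\sigma_e)_{e\ni v}}\Big)\bigotimes_{v\in V}|i_v\rangle .$$ It is called injective if for every $v$ the linear map $X\mapsto\sum_{\alpha}X_\alpha A_v^{\,\cdot}{}_{\alpha}$ from the virtual space $\bigotimes_{e\ni v}\mathbb{C}^{D_e}$ to the physical space $\mathbb{C}^{d_v}$ is injective. Theorem (Fundamental Theorem for injective PEPS). Let $A$ and $B$ be two injective PEPS on $G$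 with the same physical spaces and with bond dimensions $D_e\ge 1$ and $D'_e\ge 1$, respectively. Then $|\Psi_A\rangle=|\Psi_B\rangle$ if and only if the tensors are related by a local gauge, that is, there are complex $D_e\times D'_e$ matrices $Z_{v,e}$, for all $e\in E$ and both endpoints $v$ of $e$, such that for each edge $e=\{v,w\}$ the matrix $Z_{v,e}$ is invertible with inverse $Z_{w,e}^{T}$ (so that the matrices at the two ends of $e$ cancel when $e$ is contracted; in particular $D_e=D'_e$), and such that for all $v$, $i$ and $\beta$ $$(B_v)^{i}_{\beta}=\sum_{\alpha}\Big(\prod_{e\ni v}(Z_{v,e})_{\alpha_e\beta_e}\Big)(A_v)^{i}_{\alpha}.$$ Moreover, these gauges are unique up to multiplicative constants: if $(Z_{v,e})$ and $(Z'_{v,e})$ are two such local gauges relating $A$ to $B$, then for each edge $e$ and each endpoint $v$ of $e$ there is a constant $c_{v,e}\in\mathbb{C}\setminus\{0\}$ with $Z'_{v,e}=c_{v,e}Z_{v,e}$. -/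

import Mathlib

open scoped Matrix

namespace TensorNetwork

variable {V : Type*} [Fintype V] [DecidableEq V]

/-- The edges of the graph `G` that are incident to the vertex `v`. -/
abbrev Incident (G : SimpleGraph V) (v : V) : Type _ :=
  {e : G.edgeSet // v ∈ (e : Sym2 V)}

/-- A PEPS on the graph `G` whose particle at `v` has physical space `ℂ ^ (d v)`: every edge `e`
carries a bond dimension, and every vertex carries a tensor with one virtual index for each
incident edge (first argument of `tensor v`) and one physical index (second argument). -/
structure PEPS (G : SimpleGraph V) (d : V → ℕ) where
  /-- The dimension of the virtual space on each edge. -/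
  bondDim : G.edgeSet → ℕ
  /-- The tensor at each vertex. -/
  tensor : ∀ v : V, ((e : Incident G v) → Fin (bondDim e.1)) → Fin (d v) → ℂ

namespace PEPS

variable {G : SimpleGraph V} [DecidableRel G.Adj] {d : V → ℕ}

/-- The state generated by a PEPS, given by its coefficients in the product basis of
`⨂ v, ℂ ^ (d v)`: the virtual indices on all edges are contracted. -/
def state (A : PEPS G d) (i : ∀ v : V, Fin (d v)) : ℂ :=
  ∑ σ : (∀ e : G.edgeSet, Fin (A.bondDim e)), ∏ v : V, A.tensor v (fun e => σ e.1) (i v)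

/-- The tensor at `v` as a linear map from the virtual space (the tensor product of the spaces
`ℂ ^ (bondDim e)` over the edges `e` incident to `v`, in coordinates) to the physical space,
`X ↦ ∑ α, X α • A.tensor v α`. -/
def virtualToPhysical (A : PEPS G d) (v : V) :
    (((e : Incident G v) → Fin (A.bondDim e.1)) → ℂ) →ₗ[ℂ] (Fin (d v) → ℂ) :=
  Fintype.linearCombination ℂ (A.tensor v)

/-- A PEPS is injective if every tensor is injective as a map from the virtual space to the
physical space. -/
def IsInjective (A : PEPS G d) : Prop :=
  ∀ v : V, Function.Injective (A.virtualToPhysical v)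

end PEPS

/-- A local gauge between bond dimensions `D` and `D'`: on each edge `e = {v, w}` an invertible
matrix `Z` acting at one end of `e`, and the inverse (transposed, as its two indices are read from
the other end) acting at the other end, so that the two cancel when `e` is contracted.
`mat v e` is the matrix acting on the index `e` of the tensor at `v`. The two equations say that
`mat v e` is invertible with inverse `(mat w e)ᵀ`; in particular `D e = D' e`. -/
structure LocalGauge (G : SimpleGraph V) (D D' : G.edgeSet → ℕ) where
  /-- The gauge matrix acting at the end `v` of the edge `e`. -/
  mat : ∀ (v : V) (e : Incident G v), Matrix (Fin (D e.1)) (Fin (D' e.1)) ℂ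
  mul_transpose : ∀ (v w : V) (e : G.edgeSet) (hv : v ∈ (e : Sym2 V)) (hw : w ∈ (e : Sym2 V)),
    v ≠ w → mat v ⟨e, hv⟩ * (mat w ⟨e, hw⟩)ᵀ = 1
  transpose_mul : ∀ (v w : V) (e : G.edgeSet) (hv : v ∈ (e : Sym2 V)) (hw : w ∈ (e : Sym2 V)),
    v ≠ w → (mat w ⟨e, hw⟩)ᵀ * mat v ⟨e, hv⟩ = 1

/-- The local gauge `Z` transforms the tensors of `A` into those of `B`: each tensor of `B` is the
tensor of `A` at the same vertex with the gauge matrices contracted with its virtual indices. -/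
def LocalGauge.Relates {G : SimpleGraph V} [DecidableRel G.Adj] {d : V → ℕ} {A B : PEPS G d}
    (Z : LocalGauge G A.bondDim B.bondDim) : Prop :=
  ∀ (v : V) (β : (e : Incident G v) → Fin (B.bondDim e.1)) (i : Fin (d v)),
    B.tensor v β i =
      ∑ α : ((e : Incident G v) → Fin (A.bondDim e.1)),
        (∏ e : Incident G v, Z.mat v e (α e) (β e)) * A.tensor v α i

end TensorNetwork

/-! ### Linear algebra: intertwiners, product functions, inverses of injective tensors -/

namespace TensorNetwork

/-! Undoing the tensors of `A` at every vertex but `v` isolates `A_v` in the common state and writes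
it as a combination of the `B_v`. By symmetry `B_v = X_v A_v` with `X_v` invertible, and the family
`X` preserves every contraction (`exists_virtual_transform`).

A matrix on an edge can be moved from one end to the other. Conjugating by `X`, `X_v O X_v⁻¹` can be
traded for a matrix at the neighbour `w`, and such a matrix acts on the joint edge only
(`exists_eq_legMatrix`). So conjugation by `X_v` maps the matrix algebra of each leg onto that of
the same leg. By Skolem–Noether it is inner there, and `X_v` is a scalar times a product over the
legs (`exists_eq_mul_prod_of_conj_legMatrix`).

Preservation of contractions forces the two matrices on an edge to cancel up to a constant, absorbed
by a square root. The remaining vertex scalars have product one, so on a connected graph they can be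
pushed into the edges (`IsEdgeDistributable.of_connected`). Conversely, gauges cancel edge by edge.
For uniqueness, injectivity determines the product of the gauges at a vertex, and a nonzero product
tensor determines its factors up to constants. -/

/-- Faithfulness on both sides makes `O ↦ t` an algebra isomorphism, so by Skolem–Noether it is
conjugation by some `P`. Then `P⁻¹ * M k` commutes with all matrix units, hence is scalar. -/
theorem exists_eq_smul_of_intertwine {m n K : Type*} [Fintype m] [Fintype n] [DecidableEq m]
    [DecidableEq n] (M : K → Matrix m n ℂ)
    (hr : ∀ O : Matrix n n ℂ, (∀ k, M k * O = 0) → O = 0)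
    (hl : ∀ t : Matrix m m ℂ, (∀ k, t * M k = 0) → t = 0)
    (h₁ : ∀ O : Matrix n n ℂ, ∃ t : Matrix m m ℂ, ∀ k, M k * O = t * M k)
    (h₂ : ∀ t : Matrix m m ℂ, ∃ O : Matrix n n ℂ, ∀ k, M k * O = t * M k) :
    ∃ (P : Matrix m n ℂ) (Q : Matrix n m ℂ), P * Q = 1 ∧ Q * P = 1 ∧
      ∀ k, ∃ c : ℂ, M k = c • P := by
  choose f hf using h₁
  have hl' : ∀ t t' : Matrix m m ℂ, (∀ k, t * M k = t' * M k) → t = t' := fun t t' h =>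
    sub_eq_zero.1 (hl _ fun k => by rw [Matrix.sub_mul, h, sub_self])
  have hr' : ∀ t t' : Matrix n n ℂ, (∀ k, M k * t = M k * t') → t = t' := fun t t' h =>
    sub_eq_zero.1 (hr _ fun k => by rw [Matrix.mul_sub, h, sub_self])
  let F : Matrix n n ℂ →ₐ[ℂ] Matrix m m ℂ :=
    { toFun := f
      map_one' := hl' _ _ fun k => by rw [← hf]; simp
      map_mul' := fun x y => hl' _ _ fun k => by
        rw [← hf, ← Matrix.mul_assoc, hf, Matrix.mul_assoc, hf, Matrix.mul_assoc]
      map_zero' := hl' _ _ fun k => by rw [← hf]; simp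
      map_add' := fun x y => hl' _ _ fun k => by
        rw [← hf, Matrix.mul_add, Matrix.add_mul, hf, hf]
      commutes' := fun r => hl' _ _ fun k => by
        rw [← hf]; simp [Algebra.algebraMap_eq_smul_one] }
  have hF : Function.Bijective F := by
    constructor
    · intro x y hxy
      refine hr' _ _ fun k => ?_
      rw [hf, hf]
      exact congrArg (· * M k) hxy
    · intro t
      obtain ⟨O, hO⟩ := h₂ t
      exact ⟨O, hl' _ _ fun k => by rw [← hO k]; exact (hf O k).symm⟩
  let E : Module.End ℂ (n → ℂ) ≃ₐ[ℂ] Module.End ℂ (m → ℂ) :=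
    (Matrix.toLinAlgEquiv'.symm.trans (AlgEquiv.ofBijective F hF)).trans Matrix.toLinAlgEquiv'
  obtain ⟨T, hT⟩ := E.eq_linearEquivConjAlgEquiv
  set P := LinearMap.toMatrix' T.toLinearMap with hP
  set Q := LinearMap.toMatrix' T.symm.toLinearMap with hQ
  have hPQ : P * Q = 1 := by
    rw [hP, hQ, ← LinearMap.toMatrix'_comp]; simp
  have hQP : Q * P = 1 := by
    rw [hP, hQ, ← LinearMap.toMatrix'_comp]; simp
  have hfP : ∀ O, f O * P = P * O := by
    intro O
    have h := congrArg (fun G => G (Matrix.toLinAlgEquiv' O)) hT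
    have h' : Matrix.toLin' (f O) = T.toLinearMap ∘ₗ Matrix.toLin' O ∘ₗ T.symm.toLinearMap := by
      have h1 : E (Matrix.toLinAlgEquiv' O) = Matrix.toLin' (f O) := by
        simp [E]; rfl
      rw [← h1]
      rw [h]
      rfl
    have h2 := congrArg LinearMap.toMatrix' h'
    rw [LinearMap.toMatrix'_toLin', LinearMap.toMatrix'_comp, LinearMap.toMatrix'_comp,
      LinearMap.toMatrix'_toLin'] at h2
    rw [h2]
    change P * (O * Q) * P = _
    rw [Matrix.mul_assoc, Matrix.mul_assoc, hQP, Matrix.mul_one]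
  refine ⟨P, Q, hPQ, hQP, fun k => ?_⟩
  have hcomm : ∀ i j, Commute (Matrix.single i j 1) (Q * M k) := by
    intro i j
    set O : Matrix n n ℂ := Matrix.single i j 1
    have h1 : Q * f O = O * Q := by
      calc Q * f O = Q * (f O * P) * Q := by
            rw [Matrix.mul_assoc, Matrix.mul_assoc, hPQ, Matrix.mul_one]
        _ = _ := by rw [hfP, ← Matrix.mul_assoc, hQP, Matrix.one_mul]
    change O * (Q * M k) = Q * M k * O
    rw [Matrix.mul_assoc, hf, ← Matrix.mul_assoc, ← Matrix.mul_assoc, h1]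
  obtain ⟨c, hc⟩ := Matrix.mem_range_scalar_iff_commute_single'.2 hcomm
  refine ⟨c, ?_⟩
  calc M k = P * (Q * M k) := by rw [← Matrix.mul_assoc, hPQ, Matrix.one_mul]
    _ = c • P := by rw [← hc]; simp [Matrix.scalar_apply, ← Matrix.smul_one_eq_diagonal]

/-- Starting from a point where `f` is nonzero, coordinates are exchanged one at a time; each
exchange multiplies `f` by a ratio of values of `z e`. -/
theorem exists_eq_mul_prod {ι : Type*} [Fintype ι] [DecidableEq ι] {X : ι → Type*}
    (f : (∀ e, X e) → ℂ) (z : ∀ e, X e → ℂ)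
    (h : ∀ e p, ∃ c : ℂ, ∀ q, f (Function.update p e q) = c * z e q) :
    ∃ c : ℂ, ∀ p, f p = c * ∏ e, z e (p e) := by
  by_cases hf : ∀ p, f p = 0
  · exact ⟨0, by simpa using hf⟩
  push Not at hf
  obtain ⟨p₀, hp₀⟩ := hf
  have key : ∀ e p q, f (Function.update p e q) * z e (p e) = f p * z e q := by
    intro e p q
    obtain ⟨c, hc⟩ := h e p
    have := hc (p e)
    rw [Function.update_eq_self] at this
    rw [hc, this]; ring
  have hz : ∀ e, z e (p₀ e) ≠ 0 := by
    intro e h0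
    obtain ⟨c, hc⟩ := h e p₀
    have := hc (p₀ e)
    rw [Function.update_eq_self, h0, mul_zero] at this
    exact hp₀ this
  have main : ∀ (q : ∀ e, X e) (s : Finset ι),
      f (s.piecewise q p₀) * ∏ e ∈ s, z e (p₀ e) = f p₀ * ∏ e ∈ s, z e (q e) := by
    intro q s
    induction s using Finset.induction_on with
    | empty => simp
    | insert e s he ih =>
      rw [Finset.prod_insert he, Finset.prod_insert he, Finset.piecewise_insert]
      have := key e (s.piecewise q p₀) (q e)
      rw [Finset.piecewise_eq_of_notMem _ _ _ he] at this
      rw [← mul_assoc, this]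
      linear_combination z e (q e) * ih
  refine ⟨f p₀ / ∏ e, z e (p₀ e), fun p => ?_⟩
  have := main p Finset.univ
  rw [Finset.piecewise_univ] at this
  rw [div_mul_eq_mul_div, eq_div_iff (Finset.prod_ne_zero_iff.2 fun e _ => hz e), this]

theorem exists_left_inverse_of_injective {m n : Type*} [Fintype m] [Fintype n] [DecidableEq m]
    (A : m → n → ℂ) (hA : Function.Injective (Fintype.linearCombination ℂ A)) :
    ∃ l : Matrix n m ℂ, Matrix.of A * l = 1 := by
  have hinj : LinearMap.ker (Fintype.linearCombination ℂ A) = ⊥ := LinearMap.ker_eq_bot.2 hA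
  obtain ⟨g, hg⟩ := LinearMap.exists_leftInverse_of_injective _ hinj
  classical
  refine ⟨(LinearMap.toMatrix' g)ᵀ, ?_⟩
  ext a b
  have h1 := congrFun (LinearMap.congr_fun hg (Pi.single a 1)) b
  simp only [LinearMap.comp_apply, Fintype.linearCombination_apply_single, one_smul,
    LinearMap.id_apply] at h1
  have h2 : g (A a) = (LinearMap.toMatrix' g).mulVec (A a) := by
    rw [LinearMap.toMatrix'_mulVec]
  rw [h2] at h1
  rw [Matrix.mul_apply, Matrix.one_apply]
  simp only [Matrix.mulVec, dotProduct] at h1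
  simp only [Matrix.of_apply, Matrix.transpose_apply]
  rw [Finset.sum_congr rfl fun x _ => mul_comm _ _, h1, Pi.single_apply]
  simp [eq_comm]

end TensorNetwork

/-! ### Edges and their ends; distributing vertex scalars over edges -/

namespace TensorNetwork

theorem exists_ends {V : Type*} {G : SimpleGraph V} (e : G.edgeSet) :
    ∃ v w : V, v ∈ (e : Sym2 V) ∧ w ∈ (e : Sym2 V) ∧ v ≠ w := by
  obtain ⟨e, he⟩ := e
  induction e using Sym2.ind with
  | _ v w => exact ⟨v, w, by simp, by simp, G.ne_of_adj he⟩

theorem exists_other_end {V : Type*} {G : SimpleGraph V} (v : V) (e : G.edgeSet) :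
    ∃ w, w ∈ (e : Sym2 V) ∧ v ≠ w := by
  obtain ⟨a, b, ha, hb, hab⟩ := exists_ends e
  by_cases h : v = a
  · exact ⟨b, hb, h ▸ hab⟩
  · exact ⟨a, ha, h⟩

theorem edge_eq_of_mem {V : Type*} {G : SimpleGraph V} {v w : V} {e e' : G.edgeSet} (hvw : v ≠ w) (hv : v ∈ (e : Sym2 V))
    (hw : w ∈ (e : Sym2 V)) (hv' : v ∈ (e' : Sym2 V)) (hw' : w ∈ (e' : Sym2 V)) : e = e' :=
  Subtype.ext (((Sym2.mem_and_mem_iff hvw).1 ⟨hv, hw⟩).trans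
    ((Sym2.mem_and_mem_iff hvw).1 ⟨hv', hw'⟩).symm)

variable {V : Type*} [Fintype V] [DecidableEq V]

/-- The ways to distribute a scalar at each vertex over the incident edges, so that the two scalars
on each edge cancel. -/
def IsEdgeDistributable (G : SimpleGraph V) [DecidableRel G.Adj] (c : V → ℂˣ) : Prop :=
  ∃ r : V → G.edgeSet → ℂˣ,
    (∀ (v w : V) (e : G.edgeSet), v ∈ (e : Sym2 V) → w ∈ (e : Sym2 V) → v ≠ w →
      r v e * r w e = 1) ∧
    ∀ v, ∏ e : Incident G v, r v e.1 = c v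

variable {G : SimpleGraph V} [DecidableRel G.Adj]

theorem IsEdgeDistributable.one : IsEdgeDistributable G (1 : V → ℂˣ) :=
  ⟨fun _ _ => 1, by simp, by simp⟩

theorem IsEdgeDistributable.mul {c c' : V → ℂˣ} (h : IsEdgeDistributable G c)
    (h' : IsEdgeDistributable G c') : IsEdgeDistributable G (c * c') := by
  obtain ⟨r, hr, hc⟩ := h
  obtain ⟨r', hr', hc'⟩ := h'
  refine ⟨fun v e => r v e * r' v e, fun v w e hv hw hne => ?_, fun v => ?_⟩
  · rw [mul_mul_mul_comm, hr v w e hv hw hne, hr' v w e hv hw hne, one_mul]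
  · rw [Finset.prod_mul_distrib, hc, hc', Pi.mul_apply]

theorem IsEdgeDistributable.of_adj {v w : V} (h : G.Adj v w) (x : ℂˣ) :
    IsEdgeDistributable G (Pi.mulSingle v x * Pi.mulSingle w x⁻¹) := by
  have hvw := h.ne
  let e₀ : G.edgeSet := ⟨s(v, w), h⟩
  have he₀ : ∀ {u}, u ∈ (e₀ : Sym2 V) ↔ u = v ∨ u = w := by simp [e₀]
  refine ⟨fun u e => if e = e₀ then (if u = v then x else x⁻¹) else 1, ?_, ?_⟩
  · intro a b e ha hb hab
    by_cases he : e = e₀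
    · subst he
      rcases he₀.1 ha with rfl | rfl <;> rcases he₀.1 hb with rfl | rfl <;>
        simp_all [eq_comm]
    · simp [he]
  · intro u
    by_cases hu : u ∈ (e₀ : Sym2 V)
    · rw [Finset.prod_eq_single (⟨e₀, hu⟩ : Incident G u)]
      · rcases he₀.1 hu with rfl | rfl <;> simp [hvw, hvw.symm]
      · rintro ⟨e, he⟩ - hne
        dsimp only
        rw [if_neg]
        rintro rfl
        exact hne rfl
      · simp
    · rw [Finset.prod_eq_one]
      · rw [he₀] at hu
        push Not at hu
        simp [hu.1, hu.2]
      · rintro ⟨e, he⟩ -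
        dsimp only
        rw [if_neg]
        rintro rfl
        exact hu he

/-- Along a walk the scalars at intermediate vertices telescope. -/
theorem IsEdgeDistributable.of_reachable {v w : V} (h : G.Reachable v w) (x : ℂˣ) :
    IsEdgeDistributable G (Pi.mulSingle v x * Pi.mulSingle w x⁻¹) := by
  obtain ⟨p⟩ := h
  induction p with
  | nil => simpa [← Pi.mulSingle_mul] using IsEdgeDistributable.one
  | cons h _ ih =>
    convert (IsEdgeDistributable.of_adj h x).mul ih using 1
    rw [mul_assoc, ← mul_assoc (Pi.mulSingle _ x⁻¹ : V → ℂˣ), ← Pi.mulSingle_mul]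
    simp

/-- Every scalar is transported to a base vertex, where together they leave the inverse of the total
product, which is one. -/
theorem IsEdgeDistributable.of_connected (hG : G.Connected) (c : V → ℂˣ) (hc : ∏ v, c v = 1) :
    IsEdgeDistributable G c := by
  obtain ⟨v₀⟩ := hG.nonempty
  have h : c = ∏ v, (Pi.mulSingle v (c v) * Pi.mulSingle v₀ (c v)⁻¹) := by
    rw [Finset.prod_mul_distrib, Finset.univ_prod_mulSingle]
    have : ∏ v, (Pi.mulSingle v₀ (c v)⁻¹ : V → ℂˣ) = 1 := by
      have h1 := map_prod (MonoidHom.mulSingle (fun _ : V => ℂˣ) v₀) (fun v => (c v)⁻¹) Finset.univ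
      simp only [MonoidHom.mulSingle_apply] at h1
      rw [← h1, Finset.prod_inv_distrib, hc]
      simp
    rw [this, mul_one]
  rw [h]
  exact Finset.prod_induction _ (IsEdgeDistributable G) (fun _ _ => IsEdgeDistributable.mul)
    IsEdgeDistributable.one fun v _ => IsEdgeDistributable.of_reachable (hG v v₀) _

/-- Exchanging the products over vertices and incident edges in a contracted product tensor. -/
theorem sum_prod_incident_eq {D : G.edgeSet → ℕ} (g : ∀ v, ∀ e : Incident G v, Fin (D e.1) → ℂ) :
    ∑ σ : (∀ e, Fin (D e)), ∏ v, ∏ e : Incident G v, g v e (σ e.1) =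
      ∏ e : G.edgeSet, ∑ b : Fin (D e), ∏ x : {v // v ∈ (e : Sym2 V)}, g x.1 ⟨e, x.2⟩ b := by
  rw [Finset.prod_univ_sum, Fintype.piFinset_univ]
  refine Finset.sum_congr rfl fun σ _ => ?_
  rw [← Fintype.prod_sigma' (fun v (e : Incident G v) => g v e (σ e.1)),
    ← Fintype.prod_sigma' (fun (e : G.edgeSet) (x : {v // v ∈ (e : Sym2 V)}) =>
      g x.1 ⟨e, x.2⟩ (σ e))]
  exact Fintype.prod_equiv
    { toFun := fun p => ⟨p.2.1, p.1, p.2.2⟩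
      invFun := fun p => ⟨p.2.1, p.1, p.2.2⟩
      left_inv := fun _ => rfl
      right_inv := fun _ => rfl } _ _ fun _ => rfl

theorem prod_ends {e : Sym2 V} {v w : V} (hv : v ∈ e) (hw : w ∈ e) (hvw : v ≠ w)
    (f : {x // x ∈ e} → ℂ) : ∏ x, f x = f ⟨v, hv⟩ * f ⟨w, hw⟩ := by
  have he : e = s(v, w) := ((Sym2.mem_and_mem_iff hvw).1 ⟨hv, hw⟩)
  rw [← Finset.prod_pair (f := f) (a := ⟨v, hv⟩) (b := ⟨w, hw⟩) (by simpa using hvw)]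
  refine Finset.prod_congr ?_ fun _ _ => rfl
  ext ⟨x, hx⟩
  subst he
  simpa using hx

end TensorNetwork

/-! ### Matrices acting on single legs -/

namespace TensorNetwork

section Leg

variable {ι : Type*} [Fintype ι] [DecidableEq ι] {n n' : ι → ℕ}

/-- A matrix acting on one leg of a tensor. -/
def legMatrix (e : ι) (O : Matrix (Fin (n e)) (Fin (n e)) ℂ) :
    Matrix (∀ i, Fin (n i)) (∀ i, Fin (n i)) ℂ :=
  Matrix.of fun γ γ' => if γ' = Function.update γ e (γ' e) then O (γ e) (γ' e) else 0

/-- The block of a matrix between tensor spaces in which all indices but those of the leg `e` are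
fixed. -/
def legBlock (e : ι) (X : Matrix (∀ i, Fin (n i)) (∀ i, Fin (n' i)) ℂ)
    (k : (∀ i, Fin (n i)) × (∀ i, Fin (n' i))) : Matrix (Fin (n e)) (Fin (n' e)) ℂ :=
  Matrix.of fun b a => X (Function.update k.1 e b) (Function.update k.2 e a)

theorem legMatrix_mul_apply {m : Type*} (e : ι) (O : Matrix (Fin (n e)) (Fin (n e)) ℂ)
    (N : Matrix (∀ i, Fin (n i)) m ℂ) (γ : ∀ i, Fin (n i)) (j : m) :
    (legMatrix e O * N) γ j = ∑ a, O (γ e) a * N (Function.update γ e a) j := by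
  rw [Matrix.mul_apply]
  symm
  refine Fintype.sum_of_injective (Function.update γ e) (Function.update_injective γ e) _ _ ?_ ?_
  · intro γ' h
    rw [legMatrix, Matrix.of_apply, if_neg, zero_mul]
    exact fun h' => h ⟨_, h'.symm⟩
  · intro a
    simp [legMatrix]

theorem mul_legMatrix_apply {m : Type*} (e : ι) (O : Matrix (Fin (n e)) (Fin (n e)) ℂ)
    (N : Matrix m (∀ i, Fin (n i)) ℂ) (j : m) (γ : ∀ i, Fin (n i)) :
    (N * legMatrix e O) j γ = ∑ a, N j (Function.update γ e a) * O a (γ e) := by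
  rw [Matrix.mul_apply]
  symm
  refine Fintype.sum_of_injective (Function.update γ e) (Function.update_injective γ e) _ _ ?_ ?_
  · intro γ' h
    rw [legMatrix, Matrix.of_apply, if_neg, mul_zero]
    intro h'
    refine h ⟨γ' e, ?_⟩
    rw [h']
    simp
  · intro a
    simp [legMatrix]

/-- A leg matrix leaves the other indices fixed, so on blocks it is multiplication by one matrix
independent of `k`. This is the form required by `exists_eq_smul_of_intertwine`. -/
theorem legBlock_mul_legMatrix (e : ι) (X : Matrix (∀ i, Fin (n i)) (∀ i, Fin (n' i)) ℂ)
    (O : Matrix (Fin (n' e)) (Fin (n' e)) ℂ) (k) :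
    legBlock e (X * legMatrix e O) k = legBlock e X k * O := by
  ext b a
  rw [legBlock, Matrix.of_apply, mul_legMatrix_apply, Matrix.mul_apply]
  simp [legBlock]

theorem legBlock_legMatrix_mul (e : ι) (X : Matrix (∀ i, Fin (n i)) (∀ i, Fin (n' i)) ℂ)
    (t : Matrix (Fin (n e)) (Fin (n e)) ℂ) (k) :
    legBlock e (legMatrix e t * X) k = t * legBlock e X k := by
  ext b a
  rw [legBlock, Matrix.of_apply, legMatrix_mul_apply, Matrix.mul_apply]
  simp [legBlock]

omit [Fintype ι] in
theorem eq_of_legBlock_eq (e : ι) {X X' : Matrix (∀ i, Fin (n i)) (∀ i, Fin (n' i)) ℂ}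
    (h : ∀ k, legBlock e X k = legBlock e X' k) : X = X' := by
  ext β α
  have := congrFun (congrFun (h (β, α)) (β e)) (α e)
  simpa [legBlock] using this

theorem legBlock_one (e : ι) (γ : ∀ i, Fin (n i)) :
    legBlock e (1 : Matrix (∀ i, Fin (n i)) (∀ i, Fin (n i)) ℂ) (γ, γ) = 1 := by
  ext b a
  simp [legBlock, Matrix.one_apply, (Function.update_injective γ e).eq_iff]

theorem eq_zero_of_legMatrix_eq_zero [Nonempty (∀ i, Fin (n i))] (e : ι)
    {O : Matrix (Fin (n e)) (Fin (n e)) ℂ} (h : legMatrix e O = 0) : O = 0 := by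
  obtain ⟨γ⟩ := ‹Nonempty (∀ i, Fin (n i))›
  have h1 := legBlock_legMatrix_mul e 1 O (γ, γ)
  rw [legBlock_one, mul_one, mul_one, h] at h1
  rw [← h1]
  ext; simp [legBlock]

/-- An invertible matrix that conjugates the matrices on each leg to matrices on the same leg is,
up to a scalar, a tensor product of invertible matrices. -/
theorem exists_eq_mul_prod_of_conj_legMatrix [Nonempty (∀ i, Fin (n i))]
    [Nonempty (∀ i, Fin (n' i))]
    (X : Matrix (∀ i, Fin (n i)) (∀ i, Fin (n' i)) ℂ)
    (Y : Matrix (∀ i, Fin (n' i)) (∀ i, Fin (n i)) ℂ) (hXY : X * Y = 1) (hYX : Y * X = 1)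
    (h₁ : ∀ e O, ∃ t, X * legMatrix (n := n') e O = legMatrix (n := n) e t * X)
    (h₂ : ∀ e t, ∃ O, X * legMatrix (n := n') e O = legMatrix (n := n) e t * X) :
    ∃ (P : ∀ e, Matrix (Fin (n e)) (Fin (n' e)) ℂ) (Q : ∀ e, Matrix (Fin (n' e)) (Fin (n e)) ℂ)
      (c : ℂ), (∀ e, P e * Q e = 1) ∧ (∀ e, Q e * P e = 1) ∧
        ∀ β α, X β α = c * ∏ e, P e (β e) (α e) := by
  have hblk : ∀ e, ∃ (P : Matrix (Fin (n e)) (Fin (n' e)) ℂ) (Q : Matrix (Fin (n' e)) (Fin (n e)) ℂ),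
      P * Q = 1 ∧ Q * P = 1 ∧ ∀ k, ∃ c : ℂ, legBlock e X k = c • P := by
    intro e
    refine exists_eq_smul_of_intertwine (legBlock e X) ?_ ?_ ?_ ?_
    · intro O hO
      apply eq_zero_of_legMatrix_eq_zero e
      have : X * legMatrix e O = 0 := eq_of_legBlock_eq e fun k => by
        rw [legBlock_mul_legMatrix, hO]; ext; simp [legBlock]
      rw [← Matrix.one_mul (legMatrix e O), ← hYX, Matrix.mul_assoc, this, Matrix.mul_zero]
    · intro O hO
      apply eq_zero_of_legMatrix_eq_zero e
      have : legMatrix e O * X = 0 := eq_of_legBlock_eq e fun k => by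
        rw [legBlock_legMatrix_mul, hO]; ext; simp [legBlock]
      rw [← Matrix.mul_one (legMatrix e O), ← hXY, ← Matrix.mul_assoc, this, Matrix.zero_mul]
    · intro O
      obtain ⟨t, ht⟩ := h₁ e O
      exact ⟨t, fun k => by
        rw [← legBlock_mul_legMatrix, ← legBlock_legMatrix_mul, ht]⟩
    · intro t
      obtain ⟨O, ht⟩ := h₂ e t
      exact ⟨O, fun k => by
        rw [← legBlock_mul_legMatrix, ← legBlock_legMatrix_mul, ht]⟩
  choose P Q hPQ hQP hP using hblk
  -- The row and column index of each leg are paired, so that `X` is a function with one variable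
  -- per leg.
  obtain ⟨c, hc⟩ := exists_eq_mul_prod (X := fun e => Fin (n e) × Fin (n' e))
    (fun p => X (fun e => (p e).1) (fun e => (p e).2)) (fun e q => P e q.1 q.2) (by
      intro e p
      obtain ⟨c, hc⟩ := hP e (fun e => (p e).1, fun e => (p e).2)
      refine ⟨c, fun q => ?_⟩
      have h := congrFun (congrFun hc q.1) q.2
      simp only [legBlock, Matrix.of_apply, Matrix.smul_apply, smul_eq_mul] at h
      rw [← h]
      congr 1
      · ext i : 1
        by_cases hi : i = e
        · subst hi; simp
        · simp [hi]
      · ext i : 1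
        by_cases hi : i = e
        · subst hi; simp
        · simp [hi])
  exact ⟨P, Q, c, hPQ, hQP, fun β α => hc fun e => (β e, α e)⟩

end Leg

/-! ### Contractions and moving matrices along edges -/

section Contraction

variable {V : Type*} [Fintype V] [DecidableEq V] {G : SimpleGraph V} [DecidableRel G.Adj]

/-- The values of an assignment to the edges at the edges incident to a vertex. -/
def incidentValues {D : G.edgeSet → ℕ} (σ : ∀ e, Fin (D e)) (v : V) :
    (e : Incident G v) → Fin (D e.1) := fun e => σ e.1

/-- Contraction of all edges of a network of tensors without physical indices. -/
def contraction {D : G.edgeSet → ℕ} (φ : ∀ v : V, ((e : Incident G v) → Fin (D e.1)) → ℂ) : ℂ :=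
  ∑ σ : (∀ e, Fin (D e)), ∏ v, φ v (incidentValues σ v)

variable {D D' : G.edgeSet → ℕ}

omit [Fintype V] [DecidableRel G.Adj] in
theorem incidentValues_update_of_mem (σ : ∀ e, Fin (D e)) {v : V} {e : G.edgeSet}
    (hv : v ∈ (e : Sym2 V)) (a : Fin (D e)) :
    incidentValues (Function.update σ e a) v =
      Function.update (incidentValues σ v) (⟨e, hv⟩ : Incident G v) a := by
  ext e' : 1
  by_cases h : e' = ⟨e, hv⟩
  · subst h; simp [incidentValues]
  · have : e'.1 ≠ e := fun h' => h (Subtype.ext h')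
    simp [incidentValues, h, this]

omit [Fintype V] [DecidableRel G.Adj] in
theorem incidentValues_update_of_notMem (σ : ∀ e, Fin (D e)) {v : V} {e : G.edgeSet}
    (hv : v ∉ (e : Sym2 V)) (a : Fin (D e)) :
    incidentValues (Function.update σ e a) v = incidentValues σ v := by
  ext e' : 1
  have : e'.1 ≠ e := fun h' => hv (h' ▸ e'.2)
  simp [incidentValues, this]

/-- Every edge has an end other than `v`, and the delta tensor there fixes its label. -/
theorem contraction_eq_of_eq_single (φ : ∀ v : V, ((e : Incident G v) → Fin (D e.1)) → ℂ)
    (σ : ∀ e, Fin (D e)) (v : V) (h : ∀ w ≠ v, φ w = Pi.single (incidentValues σ w) 1) :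
    contraction φ = φ v (incidentValues σ v) := by
  rw [contraction, Finset.sum_eq_single σ]
  · rw [Finset.prod_eq_single v]
    · intro w _ hw
      simp [h w hw]
    · simp
  · intro τ _ hτ
    obtain ⟨e, he⟩ := Function.ne_iff.1 hτ
    obtain ⟨w, hw, hvw⟩ := exists_other_end v e
    refine Finset.prod_eq_zero (Finset.mem_univ w) ?_
    rw [h w hvw.symm, Pi.single_apply, if_neg]
    exact fun h' => he (congrFun h' ⟨e, hw⟩)
  · simp

theorem prod_eq_mul_mul_prod_erase {v w : V} (hvw : v ≠ w) (f : V → ℂ) :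
    ∏ u, f u = f v * f w * ∏ u ∈ (Finset.univ.erase v).erase w, f u := by
  rw [← Finset.mul_prod_erase _ _ (Finset.mem_univ v),
    ← Finset.mul_prod_erase _ _ (Finset.mem_erase.2 ⟨hvw.symm, Finset.mem_univ w⟩), mul_assoc]

/-- A matrix inserted on an edge can be moved from one end of the edge to the other. -/
theorem contraction_update_legMatrix (φ : ∀ v : V, ((e : Incident G v) → Fin (D e.1)) → ℂ)
    {v w : V} (hvw : v ≠ w) {e : G.edgeSet} (hv : v ∈ (e : Sym2 V)) (hw : w ∈ (e : Sym2 V))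
    (O : Matrix (Fin (D e)) (Fin (D e)) ℂ) :
    contraction (Function.update φ w
        (legMatrix (n := fun e : Incident G w => D e.1) ⟨e, hw⟩ O *ᵥ φ w)) =
      contraction (Function.update φ v
        (legMatrix (n := fun e : Incident G v => D e.1) ⟨e, hv⟩ Oᵀ *ᵥ φ v)) := by
  have hleg : ∀ {u : V} (hu : u ∈ (e : Sym2 V)) (N : Matrix (Fin (D e)) (Fin (D e)) ℂ)
      (σ : ∀ e, Fin (D e)),
      (legMatrix (n := fun e : Incident G u => D e.1) ⟨e, hu⟩ N *ᵥ φ u) (incidentValues σ u) =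
        ∑ a, N (σ e) a * φ u (incidentValues (Function.update σ e a) u) := by
    intro u hu N σ
    have := legMatrix_mul_apply (n := fun e : Incident G u => D e.1) ⟨e, hu⟩ N
      (Matrix.of fun γ (_ : Unit) => φ u γ) (incidentValues σ u) ()
    simp only [incidentValues_update_of_mem σ hu]
    exact this
  have hR : ∀ (σ : ∀ e, Fin (D e)) (a : Fin (D e)),
      ∏ u ∈ (Finset.univ.erase v).erase w, φ u (incidentValues (Function.update σ e a) u) =
        ∏ u ∈ (Finset.univ.erase v).erase w, φ u (incidentValues σ u) := by
    intro σ a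
    refine Finset.prod_congr rfl fun u hu => ?_
    rw [incidentValues_update_of_notMem]
    intro hue
    simp only [Finset.mem_erase, Finset.mem_univ, and_true] at hu
    have h1 := (Sym2.mem_and_mem_iff hvw).1 ⟨hv, hw⟩
    rw [h1, Sym2.mem_iff] at hue
    tauto
  have hupd : ∀ (x : V) (ψ) (σ : ∀ e, Fin (D e)), x = v ∨ x = w →
      ∏ u ∈ (Finset.univ.erase v).erase w, Function.update φ x ψ u (incidentValues σ u) =
      ∏ u ∈ (Finset.univ.erase v).erase w, φ u (incidentValues σ u) := by
    intro x ψ σ hx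
    refine Finset.prod_congr rfl fun u hu => ?_
    simp only [Finset.mem_erase, Finset.mem_univ, and_true] at hu
    rw [Function.update_of_ne]
    rintro rfl
    tauto
  simp only [contraction]
  simp only [prod_eq_mul_mul_prod_erase hvw, hupd w _ _ (Or.inr rfl), hupd v _ _ (Or.inl rfl),
    Function.update_self, Function.update_of_ne hvw, Function.update_of_ne hvw.symm, hleg,
    Finset.sum_mul, Finset.mul_sum]
  rw [← Fintype.sum_prod_type', ← Fintype.sum_prod_type']
  -- The two sums are exchanged by the involution swapping the label of `e` with the summation index
  -- of `O`.
  refine Fintype.sum_equiv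
    { toFun := fun p => (Function.update p.1 e p.2, p.1 e)
      invFun := fun p => (Function.update p.1 e p.2, p.1 e)
      left_inv := fun p => by simp
      right_inv := fun p => by simp } _ _ ?_
  rintro ⟨σ, a⟩
  simp only [Equiv.coe_fn_mk, Matrix.transpose_apply, Function.update_self,
    Function.update_idem, Function.update_eq_self, hR]
  ring

end Contraction

end TensorNetwork

/-! ### From equal states to invertible transformations that respect legs -/

namespace TensorNetwork

variable {V : Type*} [Fintype V] [DecidableEq V] {G : SimpleGraph V} [DecidableRel G.Adj]
  {D D' : G.edgeSet → ℕ}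

/-- A matrix on the virtual space at `v` that can be replaced by a matrix on the virtual space at a
neighbour acts on the joint edge only. -/
theorem exists_eq_legMatrix (hD : ∀ e, 0 < D e) {v w : V} (hvw : v ≠ w) {e : G.edgeSet}
    (hv : v ∈ (e : Sym2 V)) (hw : w ∈ (e : Sym2 V))
    (S : Matrix ((e : Incident G v) → Fin (D e.1)) ((e : Incident G v) → Fin (D e.1)) ℂ)
    (T : Matrix ((e : Incident G w) → Fin (D e.1)) ((e : Incident G w) → Fin (D e.1)) ℂ)
    (h : ∀ φ : ∀ v : V, ((e : Incident G v) → Fin (D e.1)) → ℂ,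
      contraction (Function.update φ w (T *ᵥ φ w)) =
        contraction (Function.update φ v (S *ᵥ φ v))) :
    ∃ t, S = legMatrix (n := fun e : Incident G v => D e.1) ⟨e, hv⟩ t := by
  let ref : ∀ e, Fin (D e) := fun e => ⟨0, hD e⟩
  let e₁ : Incident G v := ⟨e, hv⟩
  -- The candidate is the transposed block of `T` on the leg `e`, with the other legs of `w` at a
  -- reference value.
  refine ⟨Matrix.of fun a b => T (incidentValues (Function.update ref e b) w)
    (incidentValues (Function.update ref e a) w), ?_⟩
  ext β β'
  let σ : ∀ e, Fin (D e) := fun e =>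
    if h : v ∈ (e : Sym2 V) then β ⟨e, h⟩ else ref e
  have hσv : incidentValues σ v = β := by
    ext e' : 1
    simp [incidentValues, σ, e'.2]
  -- No second edge joins `v` and `w`, so the labels chosen around `v` affect `w` only through `e`.
  have hσw : ∀ b, incidentValues (Function.update σ e b) w =
      incidentValues (Function.update ref e b) w := by
    intro b
    ext e' : 1
    by_cases he : e'.1 = e
    · obtain ⟨e', he'⟩ := e'
      subst he
      simp [incidentValues]
    · have : v ∉ (e'.1 : Sym2 V) := fun h' => he (edge_eq_of_mem hvw h' e'.2 hv hw)
      simp [incidentValues, he, σ, this]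
  have hσe : σ e = β e₁ := by simp [σ, hv, e₁]
  -- Test network of deltas for which the side with `S` evaluates to `S β β'`.
  let φ : ∀ v : V, ((e : Incident G v) → Fin (D e.1)) → ℂ :=
    Function.update (fun u => Pi.single (incidentValues σ u) 1) v (Pi.single β' 1)
  have hφv : φ v = Pi.single β' 1 := by simp [φ]
  have hφ : ∀ u ≠ v, φ u = Pi.single (incidentValues σ u) 1 := fun u hu => by simp [φ, hu]
  have hr : contraction (Function.update φ v (S *ᵥ φ v)) = S β β' := by
    rw [contraction_eq_of_eq_single _ σ v]
    · rw [Function.update_self, hφv, hσv, Matrix.mulVec_single_one]; rfl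
    · intro u hu
      rw [Function.update_of_ne hu, hφ u hu]
  rw [← hr, ← h φ, legMatrix, Matrix.of_apply, Matrix.of_apply]
  by_cases hβ : β' = Function.update β e₁ (β' e₁)
  · rw [if_pos hβ, contraction_eq_of_eq_single _ (Function.update σ e (β' e₁)) w]
    · rw [Function.update_self, hφ w hvw.symm, Matrix.mulVec_single_one]
      rw [← hσe, ← hσw, ← hσw, Function.update_eq_self]; rfl
    · intro u hu
      rw [Function.update_of_ne hu]
      by_cases huv : u = v
      · subst huv
        rw [hφv, incidentValues_update_of_mem σ hv, hσv, ← hβ]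
      · rw [hφ u huv, incidentValues_update_of_notMem]
        intro hue
        rw [(Sym2.mem_and_mem_iff hvw).1 ⟨hv, hw⟩, Sym2.mem_iff] at hue
        tauto
  -- Here `β` and `β'` differ on an edge other than `e`. Its far end is not `w`, so the deltas at
  -- its two ends conflict and every term vanishes.
  · rw [if_neg hβ]
    refine Finset.sum_eq_zero fun τ _ => ?_
    obtain ⟨e', he'⟩ := Function.ne_iff.1 hβ
    have hne : e' ≠ e₁ := by
      rintro rfl
      simp at he'
    rw [Function.update_of_ne hne] at he'
    obtain ⟨u, hu, huv⟩ := exists_other_end v e'.1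
    have huw : u ≠ w := by
      rintro rfl
      exact hne (Subtype.ext (edge_eq_of_mem hvw e'.2 hu hv hw))
    by_cases hτ : incidentValues τ v = β'
    · refine Finset.prod_eq_zero (Finset.mem_univ u) ?_
      rw [Function.update_of_ne huw, hφ u huv.symm, Pi.single_apply, if_neg]
      intro h'
      apply he'
      rw [← hτ, ← hσv]
      exact congrFun h' ⟨e'.1, hu⟩
    · refine Finset.prod_eq_zero (Finset.mem_univ v) ?_
      rw [Function.update_of_ne hvw, hφv, Pi.single_apply, if_neg hτ]

/-- Invariance under `X` turns the insertion of `X v * O * Y v` into one of `O` on the edge. That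
moves to the neighbour `w` as `Oᵀ` and returns as a matrix at `w`, so `exists_eq_legMatrix` applies.
-/
theorem exists_mul_legMatrix_eq (hD' : ∀ e, 0 < D' e)
    (X : ∀ v, Matrix ((e : Incident G v) → Fin (D' e.1)) ((e : Incident G v) → Fin (D e.1)) ℂ)
    (Y : ∀ v, Matrix ((e : Incident G v) → Fin (D e.1)) ((e : Incident G v) → Fin (D' e.1)) ℂ)
    (hXY : ∀ v, X v * Y v = 1) (hYX : ∀ v, Y v * X v = 1)
    (hX : ∀ φ : ∀ v : V, ((e : Incident G v) → Fin (D e.1)) → ℂ,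
      contraction φ = contraction fun v => X v *ᵥ φ v)
    (v : V) (e : Incident G v) (O : Matrix (Fin (D e.1)) (Fin (D e.1)) ℂ) :
    ∃ t, X v * legMatrix (n := fun e : Incident G v => D e.1) e O =
      legMatrix (n := fun e : Incident G v => D' e.1) e t * X v := by
  obtain ⟨e, hv⟩ := e
  obtain ⟨w, hw, hvw⟩ := exists_other_end v e
  obtain ⟨t, ht⟩ := exists_eq_legMatrix hD' hvw hv hw
    (X v * legMatrix (n := fun e : Incident G v => D e.1) ⟨e, hv⟩ O * Y v)
    (X w * legMatrix (n := fun e : Incident G w => D e.1) ⟨e, hw⟩ Oᵀ * Y w) (by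
      intro ψ
      have hψ : ∀ (x : V) (N : Matrix ((e : Incident G x) → Fin (D e.1))
          ((e : Incident G x) → Fin (D e.1)) ℂ),
          contraction (Function.update ψ x ((X x * N * Y x) *ᵥ ψ x)) =
            contraction (Function.update (fun u => Y u *ᵥ ψ u) x (N *ᵥ (Y x *ᵥ ψ x))) := by
        intro x N
        rw [hX]
        congr 1
        ext u : 1
        by_cases hu : u = x
        · subst hu
          simp [Matrix.mul_assoc]
        · simp [hu, hXY]
      rw [hψ, hψ]
      have := contraction_update_legMatrix (fun u => Y u *ᵥ ψ u) hvw hv hw Oᵀ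
      rw [Matrix.transpose_transpose] at this
      exact this)
  exact ⟨t, by rw [← ht, Matrix.mul_assoc, hYX, Matrix.mul_one]⟩

namespace PEPS

variable {d : V → ℕ}

/-- The tensor at a vertex as a matrix whose rows are the virtual indices. -/
def toMatrix (A : PEPS G d) (v : V) :
    Matrix ((e : Incident G v) → Fin (A.bondDim e.1)) (Fin (d v)) ℂ := Matrix.of (A.tensor v)

theorem sum_prod_mul_state (A : PEPS G d) (l : ∀ v, Fin (d v) → ℂ) :
    ∑ i : (∀ v, Fin (d v)), (∏ v, l v (i v)) * A.state i =
      contraction fun v => A.toMatrix v *ᵥ l v := by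
  simp only [state, contraction, Finset.mul_sum]
  rw [Finset.sum_comm]
  refine Finset.sum_congr rfl fun σ _ => ?_
  simp only [Matrix.mulVec, dotProduct]
  rw [Finset.prod_univ_sum, Fintype.piFinset_univ]
  refine Finset.sum_congr rfl fun i _ => ?_
  rw [← Finset.prod_mul_distrib]
  exact Finset.prod_congr rfl fun v _ => mul_comm _ _

theorem contraction_eq_of_state_eq {A B : PEPS G d} (h : A.state = B.state)
    (l : ∀ v, Fin (d v) → ℂ) :
    contraction (fun v => A.toMatrix v *ᵥ l v) = contraction fun v => B.toMatrix v *ᵥ l v := by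
  rw [← sum_prod_mul_state, ← sum_prod_mul_state, h]

/-- If two PEPS generate the same state and the first is injective, then its tensors lie in the
span of the tensors of the second. -/
theorem exists_toMatrix_eq_mul {A B : PEPS G d} (hA_pos : ∀ e, 0 < A.bondDim e)
    (h : A.state = B.state)
    (l : ∀ v, Matrix (Fin (d v)) ((e : Incident G v) → Fin (A.bondDim e.1)) ℂ)
    (hl : ∀ v, A.toMatrix v * l v = 1) (v : V) :
    ∃ N : Matrix ((e : Incident G v) → Fin (A.bondDim e.1))
      ((e : Incident G v) → Fin (B.bondDim e.1)) ℂ, A.toMatrix v = N * B.toMatrix v := by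
  suffices ∀ α, ∃ N : ((e : Incident G v) → Fin (B.bondDim e.1)) → ℂ,
      ∀ i, A.toMatrix v α i = ∑ β, N β * B.toMatrix v β i by
    choose N hN using this
    exact ⟨Matrix.of N, by ext α i; rw [hN, Matrix.mul_apply]; rfl⟩
  intro α
  let σ : ∀ e, Fin (A.bondDim e) := fun e =>
    if h : v ∈ (e : Sym2 V) then α ⟨e, h⟩ else ⟨0, hA_pos e⟩
  have hσv : incidentValues σ v = α := by
    ext e' : 1
    simp [incidentValues, σ, e'.2]
  -- The environment of `v` in the network of `B` after the inverses of the tensors of `A` are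
  -- applied at all other vertices.
  let C : (∀ e, Fin (B.bondDim e)) → ℂ := fun τ =>
    ∏ w ∈ Finset.univ.erase v, (B.toMatrix w *ᵥ (l w *ᵥ Pi.single (incidentValues σ w) 1))
      (incidentValues τ w)
  refine ⟨fun β => ∑ τ with incidentValues τ v = β, C τ, fun i => ?_⟩
  let L : ∀ v, Fin (d v) → ℂ :=
    Function.update (fun w => l w *ᵥ Pi.single (incidentValues σ w) 1) v (Pi.single i 1)
  have h1 := contraction_eq_of_state_eq h L
  rw [contraction_eq_of_eq_single _ σ v] at h1
  · have hL : L v = Pi.single i 1 := by simp [L]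
    simp only [hL, hσv, Matrix.mulVec_single_one] at h1
    change A.toMatrix v α i = _ at h1
    rw [h1, contraction]
    simp only [Finset.sum_mul]
    refine (Finset.sum_fiberwise Finset.univ (fun τ => incidentValues τ v) _).symm.trans ?_
    refine Finset.sum_congr rfl fun β _ => ?_
    refine Finset.sum_congr rfl fun τ hτ => ?_
    rw [← Finset.mul_prod_erase _ _ (Finset.mem_univ v), mul_comm]
    refine congrArg₂ (· * ·) ?_ ?_
    · refine Finset.prod_congr rfl fun w hw => ?_
      simp only [L, Function.update_of_ne (Finset.ne_of_mem_erase hw)]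
    · rw [hL, Matrix.mulVec_single_one, (Finset.mem_filter.1 hτ).2]; rfl
  · intro w hw
    simp only [L, Function.update_of_ne hw, Matrix.mulVec_mulVec, hl, Matrix.one_mulVec]

theorem IsInjective.exists_left_inverse {A : PEPS G d} (hA : A.IsInjective) :
    ∃ l : ∀ v, Matrix (Fin (d v)) ((e : Incident G v) → Fin (A.bondDim e.1)) ℂ,
      ∀ v, A.toMatrix v * l v = 1 :=
  Classical.skolem.1 fun v => exists_left_inverse_of_injective (A.tensor v) (hA v)

/-- Two injective PEPS that generate the same state are related by invertible matrices on the
virtual spaces at the vertices. -/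
theorem exists_virtual_transform {A B : PEPS G d} (hA_pos : ∀ e, 0 < A.bondDim e)
    (hB_pos : ∀ e, 0 < B.bondDim e) (hA : A.IsInjective) (hB : B.IsInjective)
    (h : A.state = B.state) :
    ∃ (X : ∀ v, Matrix ((e : Incident G v) → Fin (B.bondDim e.1))
          ((e : Incident G v) → Fin (A.bondDim e.1)) ℂ)
      (Y : ∀ v, Matrix ((e : Incident G v) → Fin (A.bondDim e.1))
          ((e : Incident G v) → Fin (B.bondDim e.1)) ℂ),
      (∀ v, X v * Y v = 1) ∧ (∀ v, Y v * X v = 1) ∧ (∀ v, B.toMatrix v = X v * A.toMatrix v) ∧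
        ∀ φ : ∀ v : V, ((e : Incident G v) → Fin (A.bondDim e.1)) → ℂ,
          contraction φ = contraction fun v => X v *ᵥ φ v := by
  obtain ⟨l, hl⟩ := hA.exists_left_inverse
  obtain ⟨m, hm⟩ := hB.exists_left_inverse
  choose Y hY using exists_toMatrix_eq_mul hA_pos h l hl
  choose X hX using exists_toMatrix_eq_mul hB_pos h.symm m hm
  refine ⟨X, Y, fun v => ?_, fun v => ?_, hX, fun φ => ?_⟩
  · calc X v * Y v = X v * Y v * (B.toMatrix v * m v) := by rw [hm, Matrix.mul_one]
      _ = X v * (Y v * B.toMatrix v) * m v := by simp only [Matrix.mul_assoc]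
      _ = 1 := by rw [← hY, ← hX, hm]
  · calc Y v * X v = Y v * X v * (A.toMatrix v * l v) := by rw [hl, Matrix.mul_one]
      _ = Y v * (X v * A.toMatrix v) * l v := by simp only [Matrix.mul_assoc]
      _ = 1 := by rw [← hX, ← hY, hl]
  -- Physical vectors `l v *ᵥ φ v` become `φ v` in the network of `A` and `X v *ᵥ φ v` in that of
  -- `B`.
  · have h1 := contraction_eq_of_state_eq h fun v => l v *ᵥ φ v
    have hB : ∀ v, B.toMatrix v * l v = X v := fun v => by
      rw [hX, Matrix.mul_assoc, hl, Matrix.mul_one]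
    simpa only [Matrix.mulVec_mulVec, hB, hl, Matrix.one_mulVec] using h1

end PEPS

end TensorNetwork

/-! ### Products of leg matrices, gauges and their normalisation -/

namespace TensorNetwork

variable {V : Type*} [Fintype V] [DecidableEq V] {G : SimpleGraph V} [DecidableRel G.Adj]
  {D D' : G.edgeSet → ℕ}

/-- The transformation of the virtual space at `v` by matrices on the incident edges. -/
def legProduct (M : ∀ v, ∀ e : Incident G v, Matrix (Fin (D e.1)) (Fin (D' e.1)) ℂ) (v : V) :
    Matrix ((e : Incident G v) → Fin (D' e.1)) ((e : Incident G v) → Fin (D e.1)) ℂ :=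
  Matrix.of fun β α => ∏ e, M v e (α e) (β e)

theorem legProduct_one (v : V) :
    legProduct (D := D) (D' := D) (fun v (e : Incident G v) => (1 : Matrix (Fin (D e.1)) _ ℂ)) v =
      1 := by
  ext β α
  simp only [legProduct, Matrix.of_apply, Matrix.one_apply]
  rw [Finset.prod_ite_zero]
  simp [funext_iff, eq_comm]

/-- Expanding at the vertices makes the sum over the new labels factor over edges, so `M` enters
only through the product of its two matrices on each edge. -/
theorem contraction_legProduct
    (M : ∀ v, ∀ e : Incident G v, Matrix (Fin (D e.1)) (Fin (D' e.1)) ℂ)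
    (φ : ∀ v : V, ((e : Incident G v) → Fin (D e.1)) → ℂ) :
    contraction (fun v => legProduct M v *ᵥ φ v) =
      ∑ α : (∀ v, (e : Incident G v) → Fin (D e.1)), (∏ v, φ v (α v)) *
        ∏ e : G.edgeSet, ∑ b : Fin (D' e), ∏ x : {v // v ∈ (e : Sym2 V)},
          M x.1 ⟨e, x.2⟩ (α x.1 ⟨e, x.2⟩) b := by
  simp only [contraction, Matrix.mulVec, dotProduct]
  have hexp : ∀ τ : (∀ e, Fin (D' e)), ∏ v, ∑ γ, legProduct M v (incidentValues τ v) γ * φ v γ =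
      ∑ α : (∀ v, (e : Incident G v) → Fin (D e.1)),
        ∏ v, legProduct M v (incidentValues τ v) (α v) * φ v (α v) := fun τ => by
    rw [Finset.prod_univ_sum, Fintype.piFinset_univ]
  simp only [hexp]
  rw [Finset.sum_comm]
  refine Finset.sum_congr rfl fun α _ => ?_
  rw [← sum_prod_incident_eq (fun v e b => M v e (α v e) b), Finset.mul_sum]
  refine Finset.sum_congr rfl fun σ _ => ?_
  rw [← Finset.prod_mul_distrib]
  exact Finset.prod_congr rfl fun v _ => mul_comm _ _

omit [DecidableRel G.Adj] in
theorem sum_prod_ends (M : ∀ v, ∀ e : Incident G v, Matrix (Fin (D e.1)) (Fin (D' e.1)) ℂ)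
    (α : ∀ v, (e : Incident G v) → Fin (D e.1)) {v w : V} {e : G.edgeSet} (hvw : v ≠ w)
    (hv : v ∈ (e : Sym2 V)) (hw : w ∈ (e : Sym2 V)) :
    ∑ b : Fin (D' e), ∏ x : {v // v ∈ (e : Sym2 V)}, M x.1 ⟨e, x.2⟩ (α x.1 ⟨e, x.2⟩) b =
      (M v ⟨e, hv⟩ * (M w ⟨e, hw⟩)ᵀ) (α v ⟨e, hv⟩) (α w ⟨e, hw⟩) := by
  rw [Matrix.mul_apply]
  exact Finset.sum_congr rfl fun b _ => prod_ends hv hw hvw _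

namespace LocalGauge

theorem contraction_legProduct_mat (Z : LocalGauge G D D')
    (φ : ∀ v : V, ((e : Incident G v) → Fin (D e.1)) → ℂ) :
    contraction (fun v => legProduct Z.mat v *ᵥ φ v) = contraction φ := by
  have h1 : contraction φ = contraction (fun v => legProduct (D := D) (D' := D)
      (fun v (e : Incident G v) => (1 : Matrix (Fin (D e.1)) _ ℂ)) v *ᵥ φ v) := by
    simp only [legProduct_one, Matrix.one_mulVec]
  rw [h1, contraction_legProduct, contraction_legProduct]
  refine Finset.sum_congr rfl fun α _ => congrArg _ (Finset.prod_congr rfl fun e _ => ?_)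
  obtain ⟨v, w, hv, hw, hvw⟩ := exists_ends e
  rw [sum_prod_ends _ α hvw hv hw, sum_prod_ends
    (fun v (e : Incident G v) => (1 : Matrix (Fin (D e.1)) (Fin (D e.1)) ℂ)) α hvw hv hw,
    Z.mul_transpose v w e hv hw hvw, Matrix.transpose_one, Matrix.mul_one]

theorem relates_iff {d : V → ℕ} {A B : PEPS G d} (Z : LocalGauge G A.bondDim B.bondDim) :
    Z.Relates ↔ ∀ v, B.toMatrix v = legProduct Z.mat v * A.toMatrix v := by
  constructor
  · intro h v
    ext β i
    rw [Matrix.mul_apply]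
    exact h v β i
  · intro h v β i
    have := congrFun (congrFun (h v) β) i
    rw [Matrix.mul_apply] at this
    exact this

theorem Relates.state_eq {d : V → ℕ} {A B : PEPS G d} {Z : LocalGauge G A.bondDim B.bondDim}
    (h : Z.Relates) : A.state = B.state := by
  ext i
  have h1 : ∀ C : PEPS G d,
      C.state i = contraction fun v => C.toMatrix v *ᵥ Pi.single (i v) 1 := by
    intro C
    simp only [Matrix.mulVec_single_one]
    rfl
  rw [h1, h1, ← Z.contraction_legProduct_mat]
  simp only [Z.relates_iff.1 h, Matrix.mulVec_mulVec]

/-- Rescaling the matrices of a gauge by constants that cancel on each edge. -/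
def rescale (Z : LocalGauge G D D') (r : V → G.edgeSet → ℂˣ)
    (hr : ∀ (v w : V) (e : G.edgeSet), v ∈ (e : Sym2 V) → w ∈ (e : Sym2 V) → v ≠ w →
      r v e * r w e = 1) : LocalGauge G D D' where
  mat v e := (r v e.1 : ℂ) • Z.mat v e
  mul_transpose v w e hv hw hvw := by
    have := congrArg Units.val (hr v w e hv hw hvw)
    rw [Units.val_mul, Units.val_one] at this
    rw [Matrix.transpose_smul, Matrix.smul_mul, Matrix.mul_smul, smul_smul, this,
      Z.mul_transpose v w e hv hw hvw, one_smul]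
  transpose_mul v w e hv hw hvw := by
    have := congrArg Units.val (hr v w e hv hw hvw)
    rw [Units.val_mul, Units.val_one] at this
    rw [Matrix.transpose_smul, Matrix.smul_mul, Matrix.mul_smul, smul_smul, mul_comm, this,
      Z.transpose_mul v w e hv hw hvw, one_smul]

end LocalGauge

/-- If a product of matrices preserves contractions up to a constant, then the matrices at both
ends of each edge cancel up to a constant. -/
theorem exists_mul_transpose_eq_smul_one (hD : ∀ e, 0 < D e)
    (M : ∀ v, ∀ e : Incident G v, Matrix (Fin (D e.1)) (Fin (D' e.1)) ℂ) (C : ℂ)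
    (h : ∀ φ : ∀ v : V, ((e : Incident G v) → Fin (D e.1)) → ℂ,
      contraction φ = C * contraction (fun v => legProduct M v *ᵥ φ v)) (e : G.edgeSet) :
    ∃ k : ℂ, k ≠ 0 ∧ ∀ (v w : V) (hv : v ∈ (e : Sym2 V)) (hw : w ∈ (e : Sym2 V)), v ≠ w →
      M v ⟨e, hv⟩ * (M w ⟨e, hw⟩)ᵀ = k • (1 : Matrix _ _ ℂ) := by
  suffices ∃ v w : V, ∃ (hv : v ∈ (e : Sym2 V)) (hw : w ∈ (e : Sym2 V)), v ≠ w ∧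
      ∃ k : ℂ, k ≠ 0 ∧ M v ⟨e, hv⟩ * (M w ⟨e, hw⟩)ᵀ = k • (1 : Matrix _ _ ℂ) by
    obtain ⟨v, w, hv, hw, hvw, k, hk, hM⟩ := this
    refine ⟨k, hk, fun v' w' hv' hw' hvw' => ?_⟩
    have he := (Sym2.mem_and_mem_iff hvw).1 ⟨hv, hw⟩
    have h1 := hv'
    have h2 := hw'
    rw [he, Sym2.mem_iff] at h1 h2
    rcases h1 with rfl | rfl <;> rcases h2 with rfl | rfl
    · exact absurd rfl hvw'
    · exact hM
    · have := congrArg Matrix.transpose hM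
      rwa [Matrix.transpose_mul, Matrix.transpose_transpose, Matrix.transpose_smul,
        Matrix.transpose_one] at this
    · exact absurd rfl hvw'
  obtain ⟨v, w, hv, hw, hvw⟩ := exists_ends e
  refine ⟨v, w, hv, hw, hvw, ?_⟩
  let ref : ∀ e, Fin (D e) := fun e => ⟨0, hD e⟩
  let K : ℂ := ∏ e' ∈ Finset.univ.erase e, ∑ b : Fin (D' e'), ∏ x : {v // v ∈ (e' : Sym2 V)},
    M x.1 ⟨e', x.2⟩ (ref e') b
  have key : ∀ a b, (1 : Matrix (Fin (D e)) (Fin (D e)) ℂ) a b =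
      C * K * (M v ⟨e, hv⟩ * (M w ⟨e, hw⟩)ᵀ) a b := by
    intro a b
    -- Delta tensors that put `a` and `b` at the two ends of `e` and equal reference values at both
    -- ends of every other edge.
    let α : ∀ v : V, (e : Incident G v) → Fin (D e.1) := fun x =>
      incidentValues (Function.update ref e (if x = v then a else b)) x
    have hα : ∀ x (hx : x ∈ (e : Sym2 V)), α x ⟨e, hx⟩ = if x = v then a else b := by
      intro x hx
      simp [α, incidentValues]
    have hα' : ∀ x (e' : Incident G x), e'.1 ≠ e → α x e' = ref e'.1 := by
      intro x e' he'
      simp [α, incidentValues, he']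
    have hsum : ∀ {D'' : G.edgeSet → ℕ}
        (N : ∀ v, ∀ e : Incident G v, Matrix (Fin (D e.1)) (Fin (D'' e.1)) ℂ),
        contraction (fun v => legProduct N v *ᵥ Pi.single (α v) 1) =
          (N v ⟨e, hv⟩ * (N w ⟨e, hw⟩)ᵀ) a b *
            ∏ e' ∈ Finset.univ.erase e, ∑ b : Fin (D'' e'), ∏ x : {v // v ∈ (e' : Sym2 V)},
              N x.1 ⟨e', x.2⟩ (ref e') b := by
      intro D'' N
      rw [contraction_legProduct, Finset.sum_eq_single α]
      · simp only [Pi.single_eq_same, Finset.prod_const_one, one_mul]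
        rw [← Finset.mul_prod_erase _ _ (Finset.mem_univ e), sum_prod_ends N α hvw hv hw, hα, hα,
          if_pos rfl, if_neg hvw.symm]
        refine congrArg _ (Finset.prod_congr rfl fun e' he' => ?_)
        refine Finset.sum_congr rfl fun c _ => Finset.prod_congr rfl fun x _ => ?_
        rw [hα' _ _ (Finset.ne_of_mem_erase he')]
      · intro α' _ hne
        obtain ⟨x, hx⟩ := Function.ne_iff.1 hne
        rw [Finset.prod_eq_zero (Finset.mem_univ x), zero_mul]
        rw [Pi.single_apply, if_neg hx]
      · simp
    have h1 := h fun v => Pi.single (α v) 1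
    have h2 := hsum fun v (e : Incident G v) => (1 : Matrix (Fin (D e.1)) (Fin (D e.1)) ℂ)
    simp only [legProduct_one, Matrix.one_mulVec, Matrix.transpose_one, Matrix.mul_one] at h2
    rw [hsum, h2, Finset.prod_eq_one, mul_one] at h1
    · rw [h1]
      simp only [K]
      ring
    · intro e' _
      obtain ⟨x, y, hx, hy, hxy⟩ := exists_ends e'
      refine (sum_prod_ends
        (fun v (e : Incident G v) => (1 : Matrix (Fin (D e.1)) (Fin (D e.1)) ℂ))
        (fun v => incidentValues ref v) hxy hx hy).trans ?_
      simp [incidentValues]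
  have hCK : C * K ≠ 0 := by
    intro h0
    have := key (ref e) (ref e)
    simp [h0] at this
  refine ⟨(C * K)⁻¹, inv_ne_zero hCK, ?_⟩
  ext a b
  rw [Matrix.smul_apply, key a b, smul_eq_mul, inv_mul_cancel_left₀ hCK]

namespace PEPS

variable {d : V → ℕ} {A B : PEPS G d}

/-- Injective PEPS that generate the same state are related by a local gauge up to a constant at
each vertex. -/
theorem exists_localGauge_of_state_eq (hA_pos : ∀ e, 0 < A.bondDim e)
    (hB_pos : ∀ e, 0 < B.bondDim e) (hA : A.IsInjective) (hB : B.IsInjective)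
    (h : A.state = B.state) :
    ∃ (Z : LocalGauge G A.bondDim B.bondDim) (c : V → ℂ), ∏ v, c v = 1 ∧
      ∀ v, B.toMatrix v = (c v • legProduct Z.mat v) * A.toMatrix v := by
  obtain ⟨X, Y, hXY, hYX, hX, hcon⟩ := exists_virtual_transform hA_pos hB_pos hA hB h
  have hcon' : ∀ ψ : ∀ v : V, ((e : Incident G v) → Fin (B.bondDim e.1)) → ℂ,
      contraction ψ = contraction fun v => Y v *ᵥ ψ v := by
    intro ψ
    rw [hcon]
    simp only [Matrix.mulVec_mulVec, hXY, Matrix.one_mulVec]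
  have hfac : ∀ v, ∃ (P : ∀ e : Incident G v, Matrix (Fin (B.bondDim e.1)) (Fin (A.bondDim e.1)) ℂ)
      (Q : ∀ e : Incident G v, Matrix (Fin (A.bondDim e.1)) (Fin (B.bondDim e.1)) ℂ)
      (c : ℂ), (∀ e, P e * Q e = 1) ∧ (∀ e, Q e * P e = 1) ∧
        ∀ β α, X v β α = c * ∏ e, P e (β e) (α e) := by
    intro v
    have : Nonempty ((e : Incident G v) → Fin (A.bondDim e.1)) := ⟨fun e => ⟨0, hA_pos e.1⟩⟩
    have : Nonempty ((e : Incident G v) → Fin (B.bondDim e.1)) := ⟨fun e => ⟨0, hB_pos e.1⟩⟩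
    refine exists_eq_mul_prod_of_conj_legMatrix (n := fun e : Incident G v => B.bondDim e.1)
      (n' := fun e : Incident G v => A.bondDim e.1) (X v) (Y v) (hXY v) (hYX v) ?_ ?_
    · exact exists_mul_legMatrix_eq hB_pos X Y hXY hYX hcon v
    -- This is the previous case with `A` and `B` exchanged, multiplied by `X v` on both sides.
    · intro e t
      obtain ⟨O, hO⟩ := exists_mul_legMatrix_eq hA_pos Y X hYX hXY hcon' v e t
      refine ⟨O, ?_⟩
      rw [← Matrix.mul_one (X v * _), ← hYX v, ← Matrix.mul_assoc, Matrix.mul_assoc (X v), ← hO,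
        ← Matrix.mul_assoc, hXY, Matrix.one_mul]
  choose P Q c hPQ hQP hP using hfac
  let M : ∀ v, ∀ e : Incident G v, Matrix (Fin (A.bondDim e.1)) (Fin (B.bondDim e.1)) ℂ :=
    fun v e => (P v e)ᵀ
  have hXM : ∀ v, X v = c v • legProduct M v := by
    intro v
    ext β α
    rw [hP]
    rfl
  have hprod : ∀ (c : V → ℂ) (N : ∀ v, ∀ e : Incident G v,
      Matrix (Fin (A.bondDim e.1)) (Fin (B.bondDim e.1)) ℂ), (∀ v, X v = c v • legProduct N v) →
      ∀ φ : ∀ v : V, ((e : Incident G v) → Fin (A.bondDim e.1)) → ℂ,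
      contraction φ = (∏ v, c v) * contraction (fun v => legProduct N v *ᵥ φ v) := by
    intro c N hN φ
    rw [hcon]
    simp only [hN, Matrix.smul_mulVec, contraction, Finset.mul_sum, Pi.smul_apply, smul_eq_mul,
      Finset.prod_mul_distrib]
  choose k hk hkM using exists_mul_transpose_eq_smul_one hA_pos M _ (hprod c M hXM)
  -- A square root splits the constant equally between both ends, so no orientation of the edges is
  -- needed.
  have hsqrt : ∀ e, ∃ s : ℂ, k e = s * s := fun e => IsAlgClosed.exists_eq_mul_self (k e)
  choose s hs using hsqrt
  have hs0 : ∀ e, s e ≠ 0 := fun e h0 => hk e (by rw [hs, h0, zero_mul])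
  have hMP : ∀ (v w : V) (e : G.edgeSet) (hv : v ∈ (e : Sym2 V)) (hw : w ∈ (e : Sym2 V)), v ≠ w →
      P w ⟨e, hw⟩ * M v ⟨e, hv⟩ = k e • (1 : Matrix _ _ ℂ) := by
    intro v w e hv hw hvw
    have h1 : M v ⟨e, hv⟩ * P w ⟨e, hw⟩ = k e • (1 : Matrix _ _ ℂ) := hkM e v w hv hw hvw
    have h2 : M v ⟨e, hv⟩ = k e • Q w ⟨e, hw⟩ := by
      rw [← Matrix.mul_one (M v ⟨e, hv⟩), ← hPQ w ⟨e, hw⟩, ← Matrix.mul_assoc, h1, Matrix.smul_mul,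
        Matrix.one_mul]
    rw [h2, Matrix.mul_smul, hPQ]
  let Z : LocalGauge G A.bondDim B.bondDim :=
    { mat := fun v e => (s e.1)⁻¹ • M v e
      mul_transpose := fun v w e hv hw hvw => by
        rw [Matrix.transpose_smul, Matrix.smul_mul, Matrix.mul_smul, hkM e v w hv hw hvw,
          smul_smul, smul_smul, hs, ← mul_inv, inv_mul_cancel₀ (mul_ne_zero (hs0 e) (hs0 e)),
          one_smul]
      transpose_mul := fun v w e hv hw hvw => by
        rw [Matrix.transpose_smul, Matrix.smul_mul, Matrix.mul_smul, Matrix.transpose_transpose,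
          hMP v w e hv hw hvw,
          smul_smul, smul_smul, hs, ← mul_inv, inv_mul_cancel₀ (mul_ne_zero (hs0 e) (hs0 e)),
          one_smul] }
  have hXZ : ∀ v, X v = (c v * ∏ e : Incident G v, s e.1) • legProduct Z.mat v := by
    intro v
    rw [hXM]
    ext β α
    simp only [Matrix.smul_apply, legProduct, Matrix.of_apply, Z, smul_eq_mul, mul_assoc]
    rw [← Finset.prod_mul_distrib]
    refine congrArg _ (Finset.prod_congr rfl fun e _ => ?_)
    rw [mul_inv_cancel_left₀ (hs0 e.1)]
  refine ⟨Z, _, ?_, fun v => by rw [hX, hXZ]⟩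
  let ref : ∀ e, Fin (A.bondDim e) := fun e => ⟨0, hA_pos e⟩
  let φ : ∀ v : V, ((e : Incident G v) → Fin (A.bondDim e.1)) → ℂ :=
    fun v => Pi.single (incidentValues ref v) 1
  -- Both `X` and the gauge preserve contractions, so one network with nonzero contraction forces
  -- the product of the vertex scalars to be one.
  have h1 := hprod _ Z.mat hXZ φ
  have h0 : contraction φ ≠ 0 := by
    by_cases hV : Nonempty V
    · obtain ⟨v⟩ := hV
      rw [contraction_eq_of_eq_single φ ref v fun _ _ => rfl]
      simp [φ]
    · rw [not_nonempty_iff] at hV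
      have : IsEmpty G.edgeSet := ⟨fun e => (exists_ends e).elim fun v _ => hV.false v⟩
      simp [contraction]
  rw [Z.contraction_legProduct_mat] at h1
  exact (mul_eq_right₀ h0).1 h1.symm

theorem exists_relates_of_state_eq (hG : G.Connected) (hA_pos : ∀ e, 0 < A.bondDim e)
    (hB_pos : ∀ e, 0 < B.bondDim e) (hA : A.IsInjective) (hB : B.IsInjective)
    (h : A.state = B.state) : ∃ Z : LocalGauge G A.bondDim B.bondDim, Z.Relates := by
  obtain ⟨Z, c, hc, hZ⟩ := exists_localGauge_of_state_eq hA_pos hB_pos hA hB h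
  have hc0 : ∀ v, c v ≠ 0 := fun v =>
    Finset.prod_ne_zero_iff.1 (hc ▸ one_ne_zero) v (Finset.mem_univ v)
  obtain ⟨r, hr, hrc⟩ := IsEdgeDistributable.of_connected hG (fun v => Units.mk0 (c v) (hc0 v))
    (by ext; simpa using hc)
  refine ⟨Z.rescale r hr, (LocalGauge.relates_iff _).2 fun v => ?_⟩
  rw [hZ]
  congr 1
  ext β α
  have h1 := congrArg Units.val (hrc v)
  simp only [Units.coe_prod, Units.val_mk0] at h1
  simp only [legProduct, Matrix.smul_apply, Matrix.of_apply, LocalGauge.rescale, smul_eq_mul,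
    Finset.prod_mul_distrib, h1]

/-! ### Uniqueness of the gauge -/

theorem IsInjective.legProduct_mat_eq (hA : A.IsInjective)
    {Z Z' : LocalGauge G A.bondDim B.bondDim} (hZ : Z.Relates) (hZ' : Z'.Relates) (v : V) :
    legProduct Z.mat v = legProduct Z'.mat v := by
  obtain ⟨l, hl⟩ := hA.exists_left_inverse
  rw [← Matrix.mul_one (legProduct Z.mat v), ← Matrix.mul_one (legProduct Z'.mat v), ← hl v,
    ← Matrix.mul_assoc, ← Matrix.mul_assoc, ← Z.relates_iff.1 hZ, ← Z'.relates_iff.1 hZ']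

end PEPS

omit [Fintype V] [DecidableEq V] [DecidableRel G.Adj] in
theorem LocalGauge.exists_mat_ne_zero (Z : LocalGauge G D D') (hD : ∀ e, 0 < D e) (v : V)
    (e : Incident G v) : ∃ a b, Z.mat v e a b ≠ 0 := by
  by_contra! h
  obtain ⟨w, hw, hvw⟩ := exists_other_end v e.1
  have h1 := Z.mul_transpose v w e.1 e.2 hw hvw
  have h2 : Z.mat v ⟨e.1, e.2⟩ = 0 := by ext a b; exact h a b
  rw [h2, Matrix.zero_mul] at h1
  have := congrFun (congrFun h1 ⟨0, hD e.1⟩) ⟨0, hD e.1⟩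
  simp at this

/-- Fixing all other legs at nonzero entries of `Z` leaves nonzero cofactors for both gauges, and
their ratio is the constant on the leg `e`. -/
theorem LocalGauge.exists_eq_smul (Z Z' : LocalGauge G D D') (hD : ∀ e, 0 < D e) (v : V)
    (h : legProduct Z.mat v = legProduct Z'.mat v) (e : Incident G v) :
    ∃ c : ℂ, c ≠ 0 ∧ Z'.mat v e = c • Z.mat v e := by
  choose α β hαβ using Z.exists_mat_ne_zero hD v
  have hprod : ∀ (α : (e : Incident G v) → Fin (D e.1)) (β : (e : Incident G v) → Fin (D' e.1)),
      ∏ e, Z.mat v e (α e) (β e) = ∏ e, Z'.mat v e (α e) (β e) := fun α β =>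
    congrFun (congrFun h β) α
  have h0 : ∏ e, Z.mat v e (α e) (β e) ≠ 0 := Finset.prod_ne_zero_iff.2 fun e _ => hαβ e
  have h0' := h0
  rw [hprod, Finset.prod_ne_zero_iff] at h0'
  set p := ∏ x ∈ Finset.univ.erase e, Z.mat v x (α x) (β x) with hp
  set p' := ∏ x ∈ Finset.univ.erase e, Z'.mat v x (α x) (β x) with hp'
  have hp0 : p ≠ 0 := Finset.prod_ne_zero_iff.2 fun x _ => hαβ x
  have hp0' : p' ≠ 0 := Finset.prod_ne_zero_iff.2 fun x _ => h0' x (Finset.mem_univ x)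
  refine ⟨p / p', div_ne_zero hp0 hp0', ?_⟩
  ext a b
  have h1 := hprod (Function.update α e a) (Function.update β e b)
  have hcong : ∀ W : LocalGauge G D D', ∏ x ∈ Finset.univ.erase e,
      W.mat v x (Function.update α e a x) (Function.update β e b x) =
        ∏ x ∈ Finset.univ.erase e, W.mat v x (α x) (β x) := fun W =>
    Finset.prod_congr rfl fun x hx => by
      rw [Function.update_of_ne (Finset.ne_of_mem_erase hx),
        Function.update_of_ne (Finset.ne_of_mem_erase hx)]
  rw [← Finset.mul_prod_erase _ _ (Finset.mem_univ e),
    ← Finset.mul_prod_erase _ _ (Finset.mem_univ e), hcong, hcong, Function.update_self,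
    Function.update_self, ← hp, ← hp'] at h1
  rw [Matrix.smul_apply, smul_eq_mul, div_mul_eq_mul_div, eq_div_iff hp0', ← h1, mul_comm]

end TensorNetwork

theorem mainTheorem1 {V : Type*} [Fintype V] [DecidableEq V]
    (G : SimpleGraph V) [DecidableRel G.Adj] (hG : G.Connected) (d : V → ℕ)
    (A B : TensorNetwork.PEPS G d)
    (hA_pos : ∀ e, 0 < A.bondDim e) (hB_pos : ∀ e, 0 < B.bondDim e)
    (hA : A.IsInjective) (hB : B.IsInjective) :
    (A.state = B.state ↔
      ∃ Z : TensorNetwork.LocalGauge G A.bondDim B.bondDim, Z.Relates) ∧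
    (∀ Z Z' : TensorNetwork.LocalGauge G A.bondDim B.bondDim, Z.Relates → Z'.Relates →
      ∀ (v : V) (e : TensorNetwork.Incident G v),
        ∃ c : ℂ, c ≠ 0 ∧ Z'.mat v e = c • Z.mat v e) :=
  ⟨⟨TensorNetwork.PEPS.exists_relates_of_state_eq hG hA_pos hB_pos hA hB,
    fun ⟨_, hZ⟩ => hZ.state_eq⟩,
    fun Z Z' hZ hZ' v e => Z.exists_eq_smul Z' hA_pos v (hA.legProduct_mat_eq hZ hZ' v) e⟩
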